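/- Let $S\subseteq\mathbb R^n$ and $A\subseteq\mathbb R^k$ be Borel sets that are closed under coordinatewise maximum $\vee$ and minimum $\wedge$ (lattices for the product order $\le$). Let $p(s,a,\cdot)$ be a transition probability from $S\times A$ to $S$, and let $\Gamma:S\to 2^A$ be an upper semicontinuous correspondence with nonempty compact values. Assume that $p$ is upper semicontinuous, i.e. $(s,a)\mapsto\int f(s')\,p(s,a,ds')$ is u.s.c. and bounded whenever $f:S\to\mathbb R$ is u.s.c. and bounded. For a bounded u.s.c. payoff $r:S\times A\to\mathbb R$ and a discount factor $\beta\in(0,1)$, a strategy $\sigma$ is a sequence of Borel maps choosing the action $a(t)\in\Gamma(s(t))$ as a function of the history $(s(1),a(1),\dots,s(t))$; let $V_\sigma(s)=\mathbb E_\sigma\big[\sum_{t\ge1}\beta^{t-1}r(s(t),a(t))\big]$ with $s(1)=s$, let $V(s)=\sup_\sigma V_\sigma(s)$ be the value function, and let $$G(s)=\operatorname*{argmax}_{a\in\Gamma(s)}\Big\{r(s,a)+\beta\int V(s')\,p(s,a,ds')\Big\}$$ be the optimal policy correspondence. Terminology. A function $f$ on a lattice is supermodular if $f(x)+f(y)\le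 f(x\vee y)+f(x\wedge y)$ for all $x,y$. "Increasing" means weakly order preserving. $p$ is increasing (resp. supermodular) if $(s,a)\mapsto\int f(s')\,p(s,a,ds')$ is increasing (resp. supermodular) on $S\times A$ whenever the bounded Borel function $f:S\to\mathbb R$ is increasing (resp. supermodular). $\Gamma$ is supermodular if $a'\in\Gamma(s')$ and $a''\in\Gamma(s'')$ imply $a'\vee a''\in\Gamma(s'\vee s'')$ and $a'\wedge a''\in\Gamma(s'\wedge s'')$. A correspondence $\Lambda$ from a partially ordered set $E$ to a lattice is ascending if its values are nonempty sublattices and, whenever $e_1\le e_2$, $x\in\Lambda(e_2)$ and $y\in\Lambda(e_1)$, we have $x\vee y\in\Lambda(e_2)$ and $x\wedge y\in\Lambda(e_1)$. For partially ordered sets $X,E$, a function $f:X\times E\to\mathbb R$ has increasing differences if $f(x_2,e_2)-f(x_2,e_1)\ge f(x_1,e_2)-f(x_1,e_1)$ whenever $x_1\le x_2$ and $e_1\le e_2$. Theorem. Assume that $p$ is increasing and supermodular and that $\Gamma$ is supermodular. (i) Let $r:S\times A\to\mathbb R$ be bounded, u.s.c., supermodular in $(s,a)$ and increasing in $s$,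 and suppose that $\Gamma(s_1)\subseteq\Gamma(s_2)$ whenever $s_1\le s_2$. Let $G(s,\beta)$ be the optimal policy correspondence for the discount factor $\beta$. Then $(s,\beta)\mapsto G(s,\beta)$ is ascending on $S\times(0,1)$ with the product order. (ii) Let $E$ be a partially ordered set, let $\beta\in(0,1)$, and let $r(s,a,c)$, $c\in E$, be such that $r(\cdot,\cdot,c)$ is bounded, u.s.c. and supermodular in $(s,a)$ for every $c\in E$, and $r$ has increasing differences in $((s,a),c)$ on $(S\times A)\times E$. Let $G(s,c)$ be the optimal policy correspondence for the payoff $r(\cdot,\cdot,c)$. Then $(s,c)\mapsto G(s,c)$ is ascending on $S\times E$ with the product order. -/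

import Mathlib

open MeasureTheory ProbabilityTheory

namespace DiscountedDP

/-! ### Order-theoretic notions -/

section Order

/-- `f` is supermodular on the lattice `X`. -/
def Supermodular {X : Type*} [Lattice X] (f : X → ℝ) : Prop :=
  ∀ x y : X, f x + f y ≤ f (x ⊔ y) + f (x ⊓ y)

/-- `f : X × E → ℝ` has increasing differences in `(x, e)`: for all `x₁ ≤ x₂` and `e₁ ≤ e₂`,
`f (x₂, e₂) - f (x₂, e₁) ≥ f (x₁, e₂) - f (x₁, e₁)`. -/
def IncreasingDifferences {X E : Type*} [Preorder X] [Preorder E] (f : X × E → ℝ) : Prop :=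
  ∀ ⦃x₁ x₂ : X⦄, x₁ ≤ x₂ → ∀ ⦃e₁ e₂ : E⦄, e₁ ≤ e₂ →
    f (x₁, e₂) - f (x₁, e₁) ≤ f (x₂, e₂) - f (x₂, e₁)

/-- The strong set order `D ⪰ E` between two nonempty subsets of a lattice. -/
def SetDominates {X : Type*} [Lattice X] (D E : Set X) : Prop :=
  D.Nonempty ∧ E.Nonempty ∧ ∀ x ∈ D, ∀ y ∈ E, x ⊔ y ∈ D ∧ x ⊓ y ∈ E

/-- The correspondence `Λ : E → 2^X` is ascending: it has (nonempty) sublattices as values and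
`Λ e₂ ⪰ Λ e₁` in the strong set order whenever `e₁ ≤ e₂`. -/
def Ascending {E X : Type*} [Preorder E] [Lattice X] (Λ : E → Set X) : Prop :=
  (∀ e, IsSublattice (Λ e)) ∧ ∀ ⦃e₁ e₂ : E⦄, e₁ ≤ e₂ → SetDominates (Λ e₂) (Λ e₁)

/-- The correspondence `Γ` is supermodular: its graph is closed under `⊔` and `⊓`. -/
def SupermodularCorrespondence {S A : Type*} [Lattice S] [Lattice A] (Γ : S → Set A) : Prop :=
  ∀ ⦃s' s'' : S⦄ ⦃a' a'' : A⦄, a' ∈ Γ s' → a'' ∈ Γ s'' →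
    a' ⊔ a'' ∈ Γ (s' ⊔ s'') ∧ a' ⊓ a'' ∈ Γ (s' ⊓ s'')

end Order

/-- A real-valued function is bounded. -/
def BoundedFun {X : Type*} (f : X → ℝ) : Prop := ∃ M : ℝ, ∀ x, |f x| ≤ M

/-! ### Properties of a transition probability `p` from `S × A` to `S` -/

section Transition

variable {S A : Type*} [MeasurableSpace S] [MeasurableSpace A]

/-- `p` is upper semicontinuous: `(s, a) ↦ ∫ f dp(s, a)` is u.s.c. and bounded whenever `f` is. -/
def KernelUSC [TopologicalSpace S] [TopologicalSpace A] (p : Kernel (S × A) S) : Prop :=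
  ∀ f : S → ℝ, UpperSemicontinuous f → BoundedFun f →
    UpperSemicontinuous (fun x : S × A => ∫ s', f s' ∂(p x)) ∧
      BoundedFun (fun x : S × A => ∫ s', f s' ∂(p x))

/-- `p` is increasing: `(s, a) ↦ ∫ f dp(s, a)` is increasing in `(s, a)` whenever the (bounded
measurable) function `f` is increasing. -/
def KernelIncreasing [Preorder S] [Preorder A] (p : Kernel (S × A) S) : Prop :=
  ∀ f : S → ℝ, Measurable f → BoundedFun f → Monotone f →
    Monotone (fun x : S × A => ∫ s', f s' ∂(p x))

/-- `p` is supermodular: `(s, a) ↦ ∫ f dp(s, a)` is supermodular in `(s, a)` whenever the (bounded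
measurable) function `f` is supermodular. -/
def KernelSupermodular [Lattice S] [Lattice A] (p : Kernel (S × A) S) : Prop :=
  ∀ f : S → ℝ, Measurable f → BoundedFun f → Supermodular f →
    Supermodular (fun x : S × A => ∫ s', f s' ∂(p x))

end Transition

/-! ### The discounted dynamic program -/

section Model

variable {S A : Type*} [MeasurableSpace S] [MeasurableSpace A]

/-- A strategy (periods are numbered from `0`). In period `0` the history is the initial state, and
`first` picks the action; in period `t + 1` the history consists of the state-action pairs of the
periods `0, …, t` and the current state, and `next t` picks the action. All these maps are
measurable, and the action is always feasible in the current state. -/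
structure Strategy (Γ : S → Set A) where
  first : S → A
  measurable_first : Measurable first
  first_mem : ∀ s, first s ∈ Γ s
  next : ∀ t : ℕ, ((Finset.Iic t → S × A) × S) → A
  measurable_next : ∀ t, Measurable (next t)
  next_mem : ∀ (t : ℕ) (h : Finset.Iic t → S × A) (s : S), next t (h, s) ∈ Γ s

/-- The conditional law of the state-action pair of period `t + 1` given those of the periods
`0, …, t`: the state is drawn from `p (s_t, a_t)`, then the action is chosen by the strategy. -/
noncomputable def stepKernel (p : Kernel (S × A) S) {Γ : S → Set A} (σ : Strategy Γ) (t : ℕ) :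
    Kernel (Finset.Iic t → S × A) (S × A) :=
  Kernel.compProd
    (p.comap (fun h : Finset.Iic t → S × A => h ⟨t, Finset.mem_Iic.2 le_rfl⟩)
      (measurable_pi_apply _))
    (Kernel.deterministic (σ.next t) (σ.measurable_next t))

instance (p : Kernel (S × A) S) [IsMarkovKernel p] {Γ : S → Set A} (σ : Strategy Γ) (t : ℕ) :
    IsMarkovKernel (stepKernel p σ t) := by
  unfold stepKernel; infer_instance

/-- The law of the process `(s_t, a_t)` on the space of infinite histories that is induced by the
initial state `s`, the strategy `σ` and the transition probability `p` (Ionescu-Tulcea). -/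
noncomputable def histLaw (p : Kernel (S × A) S) [IsMarkovKernel p] {Γ : S → Set A}
    (σ : Strategy Γ) (s : S) : Measure (ℕ → S × A) :=
  Kernel.traj (X := fun _ => S × A) (stepKernel p σ) 0 (fun _ => (s, σ.first s))

/-- The expected discounted payoff of the strategy `σ` from the initial state `s`. -/
noncomputable def payoff (p : Kernel (S × A) S) [IsMarkovKernel p] {Γ : S → Set A}
    (r : S × A → ℝ) (β : ℝ) (σ : Strategy Γ) (s : S) : ℝ :=
  ∫ ω, ∑' t : ℕ, β ^ t * r (ω t) ∂(histLaw p σ s)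

/-- The value function `V s = sup_σ V_σ s`. -/
noncomputable def valueFn (p : Kernel (S × A) S) [IsMarkovKernel p] (Γ : S → Set A)
    (r : S × A → ℝ) (β : ℝ) (s : S) : ℝ :=
  ⨆ σ : Strategy Γ, payoff p r β σ s

/-- The optimal policy correspondence
`G s = argmax_{a ∈ Γ s} { r (s, a) + β ∫ V dp(s, a) }`, with `V` the value function. -/
def optimalPolicy (p : Kernel (S × A) S) [IsMarkovKernel p] (Γ : S → Set A)
    (r : S × A → ℝ) (β : ℝ) (s : S) : Set A :=
  {a ∈ Γ s | IsMaxOn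
    (fun a' : A => r (s, a') + β * ∫ s', valueFn p Γ r β s' ∂(p (s, a'))) (Γ s) a}

end Model

end DiscountedDP

open DiscountedDP

/-! The core is a comparison of two programs, `setDominates_optimalPolicy`. Let `w₁`, `w₂` be their
action values, with `w₁` supermodular and `w₂ - w₁` increasing in `(s, a)`. Then a value of `w₂` at
one point and of `w₁` at another do not decrease in sum when moved to the join and the meet
(`JointlySupermodular`). Since the graph of `Γ` is a sublattice, this passes to the maximized
functions, so their difference is again increasing; at comparable states it orders the sets of
maximizers (`JointlySupermodular.argmax_sup_inf`). As `p` is increasing, monotonicity of the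
difference survives each step of value iteration and its limit.

For a change of payoff this is all that is needed. For a change of discount factor, the extra term
`(β₂ - β₁) ∫ v₂ dp` must also increase, so the iterates have to be increasing themselves; this is
where monotone `r` and `Γ` enter.

The limit of value iteration must also be the supremum over strategies. A telescoping sum
(`payoff_eq_add_tsum`) bounds every payoff by it, with equality for a measurable optimal policy.
Supermodularity supplies one: the greatest maximizer. -/

namespace DiscountedDP

open Filter Topology

/-! ### Joint supermodularity of a pair of functions -/

section Order

/-- The pair `f, g`, seen as one function on `X × {1 > 0}`, is supermodular across the two levels.
For `f = g` this is supermodularity of `f`. -/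
def JointlySupermodular {X : Type*} [Lattice X] (f g : X → ℝ) : Prop :=
  ∀ x y : X, f x + g y ≤ f (x ⊔ y) + g (x ⊓ y)

/-- `v s` is the maximum of `w (s, ·)` on `Γ s`, for every `s`. -/
def IsMaxValue {S A : Type*} (Γ : S → Set A) (w : S × A → ℝ) (v : S → ℝ) : Prop :=
  ∀ s, IsGreatest ((fun a => w (s, a)) '' Γ s) (v s)

variable {X S A : Type*}

lemma JointlySupermodular.monotone_sub [Lattice X] {f g : X → ℝ} (h : JointlySupermodular f g) :
    Monotone fun x => f x - g x := by
  intro x y hxy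
  have := h x y
  rw [sup_eq_right.2 hxy, inf_eq_left.2 hxy] at this
  dsimp only
  linarith

/-- Replacing `x` by `x ⊔ y` in `f - g` reduces the claim to supermodularity of the lower function
`g`; nothing is asked of `f` alone. -/
lemma Supermodular.jointlySupermodular [Lattice X] {f g : X → ℝ} (hg : Supermodular g)
    (h : Monotone fun x => f x - g x) : JointlySupermodular f g := by
  intro x y
  have h1 := h (le_sup_left : x ≤ x ⊔ y)
  have h2 := hg x y
  dsimp only at h1
  linarith

lemma IsMaxValue.le {Γ : S → Set A} {w : S × A → ℝ} {v : S → ℝ} (h : IsMaxValue Γ w v)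
    {s : S} {a : A} (ha : a ∈ Γ s) : w (s, a) ≤ v s :=
  (h s).2 ⟨a, ha, rfl⟩

lemma IsMaxValue.exists_eq {Γ : S → Set A} {w : S × A → ℝ} {v : S → ℝ} (h : IsMaxValue Γ w v)
    (s : S) : ∃ a ∈ Γ s, w (s, a) = v s :=
  (h s).1

lemma IsMaxValue.isMaxOn_iff {Γ : S → Set A} {w : S × A → ℝ} {v : S → ℝ} (h : IsMaxValue Γ w v)
    {s : S} {a : A} (ha : a ∈ Γ s) : IsMaxOn (fun a' => w (s, a')) (Γ s) a ↔ w (s, a) = v s := by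
  constructor
  · intro hm
    obtain ⟨b, hb, hbv⟩ := h.exists_eq s
    exact le_antisymm (h.le ha) (hbv ▸ hm hb)
  · intro e b hb
    exact (h.le hb).trans_eq e.symm

/-- The join and meet of two maximizers are feasible at the join and meet of the states, hence
bounded by the maxima there. -/
lemma JointlySupermodular.isMaxValue [Lattice S] [Lattice A] {Γ : S → Set A}
    (hΓ : SupermodularCorrespondence Γ) {w₁ w₂ : S × A → ℝ} {v₁ v₂ : S → ℝ}
    (h₁ : IsMaxValue Γ w₁ v₁) (h₂ : IsMaxValue Γ w₂ v₂) (hw : JointlySupermodular w₂ w₁) :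
    JointlySupermodular v₂ v₁ := by
  intro s t
  obtain ⟨a, ha, hav⟩ := h₂.exists_eq s
  obtain ⟨b, hb, hbv⟩ := h₁.exists_eq t
  have h := hw (s, a) (t, b)
  have hab := hΓ ha hb
  have e1 := h₂.le hab.1
  have e2 := h₁.le hab.2
  rw [hav, hbv, Prod.mk_sup_mk, Prod.mk_inf_mk] at h
  linarith

/-- The two new values sum to at least the two maxima, and neither exceeds its own maximum, so both
are equal to it. -/
lemma JointlySupermodular.argmax_sup_inf [Lattice S] [Lattice A] {Γ : S → Set A}
    (hΓ : SupermodularCorrespondence Γ) {w₁ w₂ : S × A → ℝ} {v₁ v₂ : S → ℝ}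
    (h₁ : IsMaxValue Γ w₁ v₁) (h₂ : IsMaxValue Γ w₂ v₂) (hw : JointlySupermodular w₂ w₁)
    {s₁ s₂ : S} (hs : s₁ ≤ s₂) {a b : A} (ha : a ∈ Γ s₂) (hb : b ∈ Γ s₁)
    (hav : w₂ (s₂, a) = v₂ s₂) (hbv : w₁ (s₁, b) = v₁ s₁) :
    (a ⊔ b ∈ Γ s₂ ∧ w₂ (s₂, a ⊔ b) = v₂ s₂) ∧ a ⊓ b ∈ Γ s₁ ∧ w₁ (s₁, a ⊓ b) = v₁ s₁ := by
  have h := hw (s₂, a) (s₁, b)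
  have hab := hΓ ha hb
  rw [sup_eq_left.2 hs, inf_eq_right.2 hs] at hab
  rw [Prod.mk_sup_mk, Prod.mk_inf_mk, sup_eq_left.2 hs, inf_eq_right.2 hs] at h
  have e1 := h₂.le hab.1
  have e2 := h₁.le hab.2
  exact ⟨⟨hab.1, by linarith⟩, hab.2, by linarith⟩

lemma IsMaxValue.monotone [Preorder S] {Γ : S → Set A} {w : S × A → ℝ} {v : S → ℝ}
    (h : IsMaxValue Γ w v) (hΓ : ∀ ⦃s₁ s₂ : S⦄, s₁ ≤ s₂ → Γ s₁ ⊆ Γ s₂)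
    (hw : ∀ a : A, Monotone fun s : S => w (s, a)) : Monotone v := by
  intro s t hst
  obtain ⟨a, ha, hav⟩ := h.exists_eq s
  rw [← hav]
  exact (hw a hst).trans (h.le (hΓ hst ha))

/-- Maximization is nonexpansive in the sup norm; combined with `abs_actionValue_sub_le` this makes
the Bellman operator a `β`-contraction. -/
lemma IsMaxValue.abs_sub_le {Γ : S → Set A} {w₁ w₂ : S × A → ℝ} {v₁ v₂ : S → ℝ}
    (h₁ : IsMaxValue Γ w₁ v₁) (h₂ : IsMaxValue Γ w₂ v₂) {C : ℝ}
    (hC : ∀ x, |w₁ x - w₂ x| ≤ C) (s : S) : |v₁ s - v₂ s| ≤ C := by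
  obtain ⟨a, ha, hav⟩ := h₁.exists_eq s
  obtain ⟨b, hb, hbv⟩ := h₂.exists_eq s
  have h1 := abs_le.1 (hC (s, a))
  have h2 := abs_le.1 (hC (s, b))
  have h3 := h₁.le hb
  have h4 := h₂.le ha
  exact abs_le.2 ⟨by linarith, by linarith⟩

lemma IsMaxValue.boundedFun {Γ : S → Set A} {w : S × A → ℝ} {v : S → ℝ} (h : IsMaxValue Γ w v)
    (hw : BoundedFun w) : BoundedFun v := by
  obtain ⟨M, hM⟩ := hw
  refine ⟨M, fun s => ?_⟩
  obtain ⟨a, -, hav⟩ := h.exists_eq s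
  exact hav ▸ hM _

end Order

/-! ### Maximization over an upper hemicontinuous correspondence -/

section Semicontinuity

variable {S A : Type*} [TopologicalSpace S] [TopologicalSpace A]

/-- By the tube lemma a neighbourhood of `{s} × Γ s` in `O` contains a product `U × W`, and upper
hemicontinuity keeps nearby values of `Γ` in `W`. -/
lemma isOpen_forall_mem_correspondence {Γ : S → Set A} (hΓ : UpperHemicontinuous Γ)
    (hΓc : ∀ s, IsCompact (Γ s)) {O : Set (S × A)} (hO : IsOpen O) :
    IsOpen {s | ∀ a ∈ Γ s, (s, a) ∈ O} := by
  rw [isOpen_iff_mem_nhds]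
  intro s hs
  obtain ⟨U, W, hU, hW, hsU, hΓW, hUW⟩ :=
    generalized_tube_lemma (isCompact_singleton (x := s)) (hΓc s) hO (by
      rintro ⟨s', a⟩ ⟨rfl, ha⟩
      exact hs a ha)
  filter_upwards [hΓ.forall_isOpen s W hW hΓW, hU.mem_nhds (hsU rfl)] with t ht htU a ha
  exact hUW ⟨htU, ht ha⟩

lemma IsMaxValue.upperSemicontinuous {Γ : S → Set A} (hΓ : UpperHemicontinuous Γ)
    (hΓc : ∀ s, IsCompact (Γ s)) {w : S × A → ℝ} (hw : UpperSemicontinuous w) {v : S → ℝ}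
    (h : IsMaxValue Γ w v) : UpperSemicontinuous v := by
  rw [upperSemicontinuous_iff_isOpen_preimage]
  intro y
  convert! isOpen_forall_mem_correspondence hΓ hΓc (hw.isOpen_preimage y) using 1
  ext s
  constructor
  · intro hs a ha
    exact (h.le ha).trans_lt hs
  · intro hs
    obtain ⟨a, ha, hav⟩ := h.exists_eq s
    exact hav.symm.trans_lt (hs a ha)

lemma exists_isMaxValue {Γ : S → Set A} (hΓne : ∀ s, (Γ s).Nonempty)
    (hΓc : ∀ s, IsCompact (Γ s)) {w : S × A → ℝ} (hw : UpperSemicontinuous w) :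
    ∃ v, IsMaxValue Γ w v := by
  have (s : S) : ∃ y, IsGreatest ((fun a => w (s, a)) '' Γ s) y := by
    have hws : UpperSemicontinuousOn (fun a => w (s, a)) (Γ s) :=
      (hw.comp (Continuous.prodMk_right s)).upperSemicontinuousOn _
    obtain ⟨a, ha, ham⟩ := hws.exists_isMaxOn (hΓne s) (hΓc s)
    exact ⟨w (s, a), ⟨a, ha, rfl⟩, by rintro _ ⟨b, hb, rfl⟩; exact ham hb⟩
  choose v hv using this
  exact ⟨v, hv⟩

lemma upperSemicontinuous_of_forall_exists_abs_sub_le {f : S → ℝ}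
    (h : ∀ ε > 0, ∃ g : S → ℝ, UpperSemicontinuous g ∧ ∀ s, |g s - f s| ≤ ε) :
    UpperSemicontinuous f := by
  intro s y hy
  obtain ⟨g, hg, hgf⟩ := h ((y - f s) / 3) (by linarith)
  have h1 := abs_le.1 (hgf s)
  filter_upwards [hg s (y - (y - f s) / 3) (by linarith)] with t ht
  have h2 := abs_le.1 (hgf t)
  linarith

/-- The set of states at which a maximizer lies in the closed set `F` is measurable. -/
lemma IsMaxValue.measurableSet_exists_mem [MeasurableSpace S] [OpensMeasurableSpace S]
    {Γ : S → Set A} (hΓ : UpperHemicontinuous Γ) (hΓc : ∀ s, IsCompact (Γ s)) {w : S × A → ℝ}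
    (hw : UpperSemicontinuous w) {v : S → ℝ} (h : IsMaxValue Γ w v) {F : Set A}
    (hF : IsClosed F) : MeasurableSet {s | ∃ a ∈ Γ s, a ∈ F ∧ w (s, a) = v s} := by
  have hv : Measurable v := (h.upperSemicontinuous hΓ hΓc hw).measurable
  -- No maximizer lies in `F` iff a rational `q ≤ v s` exceeds `w` on all of `Γ s ∩ F`: by
  -- compactness the maximum there is attained, leaving a gap below `v s`.
  have hset : {s | ∃ a ∈ Γ s, a ∈ F ∧ w (s, a) = v s} =
      (⋃ q : ℚ, {s | ∀ a ∈ Γ s, (s, a) ∈ w ⁻¹' Set.Iio (q : ℝ) ∪ Prod.snd ⁻¹' Fᶜ} ∩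
        {s | (q : ℝ) ≤ v s})ᶜ := by
    ext s
    simp only [Set.mem_ofPred_eq, Set.mem_compl_iff, Set.mem_iUnion, Set.mem_inter_iff, not_exists,
      not_and, not_le]
    constructor
    · rintro ⟨a, ha, haF, hav⟩ q hq
      rcases hq a ha with h' | h'
      · exact hav ▸ h'
      · exact absurd haF h'
    · intro hq
      by_contra! hne
      have hws : UpperSemicontinuousOn (fun a => w (s, a)) (Γ s ∩ F) :=
        (hw.comp (Continuous.prodMk_right s)).upperSemicontinuousOn _
      obtain ⟨q, hqv, hqa⟩ : ∃ q : ℚ, (q : ℝ) < v s ∧ ∀ a ∈ Γ s ∩ F, w (s, a) < q := by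
        rcases (Γ s ∩ F).eq_empty_or_nonempty with he | he
        · obtain ⟨q, hq⟩ := exists_rat_lt (v s)
          exact ⟨q, hq, by simp [he]⟩
        · obtain ⟨a, ha, ham⟩ := hws.exists_isMaxOn he ((hΓc s).inter_right hF)
          obtain ⟨q, hq1, hq2⟩ :=
            exists_rat_btwn (lt_of_le_of_ne (h.le ha.1) (hne a ha.1 ha.2))
          exact ⟨q, hq2, fun b hb => lt_of_le_of_lt (ham hb) hq1⟩
      refine (hq q fun a ha => ?_).not_gt hqv
      by_cases haF : a ∈ F
      · exact Or.inl (hqa a ⟨ha, haF⟩)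
      · exact Or.inr haF
  rw [hset]
  refine (MeasurableSet.iUnion fun q => ?_).compl
  refine (isOpen_forall_mem_correspondence hΓ hΓc ?_).measurableSet.inter
    (measurableSet_le measurable_const hv)
  exact (hw.isOpen_preimage _).union (hF.isOpen_compl.preimage continuous_snd)

end Semicontinuity

/-! ### The Bellman operator -/

section Bellman

variable {S A : Type*} [MeasurableSpace S] [MeasurableSpace A]

/-- The payoff of an action followed by the continuation value `v`. -/
noncomputable def actionValue (p : Kernel (S × A) S) (r : S × A → ℝ) (β : ℝ) (v : S → ℝ) :
    S × A → ℝ :=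
  fun x => r x + β * ∫ s', v s' ∂(p x)

lemma BoundedFun.integrable {X : Type*} [MeasurableSpace X] {f : X → ℝ} (hf : BoundedFun f)
    (hm : Measurable f) (μ : Measure X) [IsFiniteMeasure μ] : Integrable f μ := by
  obtain ⟨M, hM⟩ := hf
  exact Integrable.of_bound hm.aestronglyMeasurable M (ae_of_all _ fun x => hM x)

lemma abs_integral_le_of_forall_abs_le {X : Type*} [MeasurableSpace X] {f : X → ℝ} {M : ℝ}
    (hM : ∀ x, |f x| ≤ M) (μ : Measure X) [IsProbabilityMeasure μ] : |∫ x, f x ∂μ| ≤ M := by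
  simpa using norm_integral_le_of_norm_le_const (μ := μ) (f := f) (C := M)
    (ae_of_all _ fun x => hM x)

lemma BoundedFun.integral {X Y : Type*} [MeasurableSpace X] [MeasurableSpace Y] {f : Y → ℝ}
    (hf : BoundedFun f) (κ : Kernel X Y) [IsMarkovKernel κ] :
    BoundedFun fun x => ∫ y, f y ∂(κ x) := by
  obtain ⟨M, hM⟩ := hf
  exact ⟨M, fun x => abs_integral_le_of_forall_abs_le hM _⟩

lemma BoundedFun.add {X : Type*} {f g : X → ℝ} (hf : BoundedFun f) (hg : BoundedFun g) :
    BoundedFun fun x => f x + g x := by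
  obtain ⟨M, hM⟩ := hf
  obtain ⟨N, hN⟩ := hg
  exact ⟨M + N, fun x => (abs_add_le _ _).trans (add_le_add (hM x) (hN x))⟩

lemma BoundedFun.const_mul {X : Type*} {f : X → ℝ} (hf : BoundedFun f) (c : ℝ) :
    BoundedFun fun x => c * f x := by
  obtain ⟨M, hM⟩ := hf
  exact ⟨|c| * M, fun x => by rw [abs_mul]; exact mul_le_mul_of_nonneg_left (hM x) (abs_nonneg c)⟩

lemma BoundedFun.sub {X : Type*} {f g : X → ℝ} (hf : BoundedFun f) (hg : BoundedFun g) :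
    BoundedFun fun x => f x - g x := by
  simpa [sub_eq_add_neg] using hf.add (hg.const_mul (-1))

lemma BoundedFun.comp {X Y : Type*} {f : Y → ℝ} (hf : BoundedFun f) (g : X → Y) :
    BoundedFun fun x => f (g x) :=
  hf.imp fun _ h x => h (g x)

lemma BoundedFun.actionValue {p : Kernel (S × A) S} [IsMarkovKernel p] {r : S × A → ℝ}
    (hr : BoundedFun r) (β : ℝ) {v : S → ℝ} (hv : BoundedFun v) :
    BoundedFun (actionValue p r β v) :=
  hr.add ((hv.integral p).const_mul β)

lemma measurable_actionValue (p : Kernel (S × A) S) [IsMarkovKernel p] {r : S × A → ℝ}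
    (hr : Measurable r) (β : ℝ) {v : S → ℝ} (hv : Measurable v) :
    Measurable (actionValue p r β v) :=
  hr.add ((hv.stronglyMeasurable.integral_kernel (κ := p)).measurable.const_mul β)

lemma upperSemicontinuous_actionValue [TopologicalSpace S] [TopologicalSpace A]
    {p : Kernel (S × A) S} (hp : KernelUSC p) {r : S × A → ℝ} (hr : UpperSemicontinuous r)
    {β : ℝ} (hβ : 0 ≤ β) {v : S → ℝ} (hv : UpperSemicontinuous v) (hvb : BoundedFun v) :
    UpperSemicontinuous (actionValue p r β v) :=
  hr.add ((continuous_const_mul β).comp_upperSemicontinuous (hp v hv hvb).1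
    fun _ _ h => mul_le_mul_of_nonneg_left h hβ)

lemma abs_actionValue_sub_le (p : Kernel (S × A) S) [IsMarkovKernel p] (r : S × A → ℝ)
    {β : ℝ} (hβ : 0 ≤ β) {u v : S → ℝ} (hu : Measurable u) (hub : BoundedFun u)
    (hv : Measurable v) (hvb : BoundedFun v) {C : ℝ} (hC : ∀ s, |u s - v s| ≤ C) (x : S × A) :
    |actionValue p r β u x - actionValue p r β v x| ≤ β * C := by
  have h : actionValue p r β u x - actionValue p r β v x = β * ∫ s, (u s - v s) ∂(p x) := by
    rw [integral_sub (hub.integrable hu _) (hvb.integrable hv _)]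
    simp only [actionValue]
    ring
  rw [h, abs_mul, abs_of_nonneg hβ]
  exact mul_le_mul_of_nonneg_left (abs_integral_le_of_forall_abs_le hC _) hβ

/-- `v` is the sequence of value iterates that starts at the zero function. -/
structure IsValueIteration [TopologicalSpace S] (p : Kernel (S × A) S) (Γ : S → Set A)
    (r : S × A → ℝ) (β : ℝ) (v : ℕ → S → ℝ) : Prop where
  zero : v 0 = 0
  upperSemicontinuous : ∀ n, UpperSemicontinuous (v n)
  boundedFun : ∀ n, BoundedFun (v n)
  isMaxValue : ∀ n, IsMaxValue Γ (actionValue p r β (v n)) (v (n + 1))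

variable [TopologicalSpace S] [TopologicalSpace A]
  {p : Kernel (S × A) S} [IsMarkovKernel p] {Γ : S → Set A} {r : S × A → ℝ} {β : ℝ}

/-- Iterating on the subtype of bounded u.s.c. functions carries along the regularity that makes the
next maximum attained. -/
lemma exists_isValueIteration (hp : KernelUSC p) (hΓ : UpperHemicontinuous Γ)
    (hΓne : ∀ s, (Γ s).Nonempty) (hΓc : ∀ s, IsCompact (Γ s)) (hr : UpperSemicontinuous r)
    (hrb : BoundedFun r) (hβ : 0 ≤ β) : ∃ v, IsValueIteration p Γ r β v := by
  have step (v : {v : S → ℝ // UpperSemicontinuous v ∧ BoundedFun v}) :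
      ∃ v' : {v : S → ℝ // UpperSemicontinuous v ∧ BoundedFun v},
        IsMaxValue Γ (actionValue p r β v.1) v'.1 := by
    have hu := upperSemicontinuous_actionValue hp hr hβ v.2.1 v.2.2
    obtain ⟨v', hv'⟩ := exists_isMaxValue hΓne hΓc hu
    exact ⟨⟨v', hv'.upperSemicontinuous hΓ hΓc hu, hv'.boundedFun (hrb.actionValue β v.2.2)⟩, hv'⟩
  choose T hT using step
  let z : {v : S → ℝ // UpperSemicontinuous v ∧ BoundedFun v} :=
    ⟨0, upperSemicontinuous_const, 0, by simp⟩
  exact ⟨fun n => (T^[n] z).1,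
    { zero := rfl
      upperSemicontinuous := fun n => (T^[n] z).2.1
      boundedFun := fun n => (T^[n] z).2.2
      isMaxValue := fun n => by
        rw [Function.iterate_succ_apply']
        exact hT _ }⟩

/-- Value iteration converges to a bounded u.s.c. solution of the Bellman equation. -/
lemma IsValueIteration.exists_tendsto [OpensMeasurableSpace S] (hp : KernelUSC p)
    (hΓne : ∀ s, (Γ s).Nonempty) (hΓc : ∀ s, IsCompact (Γ s)) (hr : UpperSemicontinuous r)
    (hβ : 0 ≤ β) (hβ' : β < 1) {v : ℕ → S → ℝ}
    (hv : IsValueIteration p Γ r β v) :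
    ∃ V : S → ℝ, UpperSemicontinuous V ∧ BoundedFun V ∧ IsMaxValue Γ (actionValue p r β V) V ∧
      ∀ s, Tendsto (fun n => v n s) atTop (𝓝 (V s)) := by
  obtain ⟨M, hM⟩ := hv.boundedFun 1
  have hm (n : ℕ) : Measurable (v n) := (hv.upperSemicontinuous n).measurable
  have hdist (n : ℕ) (s : S) : |v n s - v (n + 1) s| ≤ M * β ^ n := by
    induction n generalizing s with
    | zero => simpa [hv.zero] using hM s
    | succ n ih =>
      refine ((hv.isMaxValue n).abs_sub_le (hv.isMaxValue (n + 1)) (fun x =>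
        abs_actionValue_sub_le p r hβ (hm n) (hv.boundedFun n) (hm _) (hv.boundedFun _) ih x)
        s).trans_eq ?_
      ring
  have hlim (s : S) : ∃ y, Tendsto (fun n => v n s) atTop (𝓝 y) :=
    cauchySeq_tendsto_of_complete (cauchySeq_of_le_geometric β M hβ' fun n => hdist n s)
  choose V hV using hlim
  have hVdist (n : ℕ) (s : S) : |v n s - V s| ≤ M * β ^ n / (1 - β) :=
    dist_le_of_le_geometric_of_tendsto β M hβ' (fun n => hdist n s) (hV s) n
  have h0 : Tendsto (fun n => M * β ^ n / (1 - β)) atTop (𝓝 0) := by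
    simpa using ((tendsto_pow_atTop_nhds_zero_of_lt_one hβ hβ').const_mul M).div_const (1 - β)
  have hVu : UpperSemicontinuous V := by
    refine upperSemicontinuous_of_forall_exists_abs_sub_le fun ε hε => ?_
    obtain ⟨n, hn⟩ := (h0.eventually (gt_mem_nhds hε)).exists
    exact ⟨v n, hv.upperSemicontinuous n, fun s => (hVdist n s).trans hn.le⟩
  have hVb : BoundedFun V :=
    ⟨M * β ^ 0 / (1 - β), fun s => by simpa [hv.zero] using hVdist 0 s⟩
  refine ⟨V, hVu, hVb, ?_, hV⟩
  obtain ⟨V', hV'⟩ :=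
    exists_isMaxValue hΓne hΓc (upperSemicontinuous_actionValue hp hr hβ hVu hVb)
  -- By contraction `v (n + 1)` tends to `V'`, the Bellman image of `V`, as well as to `V`.
  suffices V' = V from this ▸ hV'
  funext s
  refine tendsto_nhds_unique ?_ ((tendsto_add_atTop_iff_nat 1).2 (hV s))
  rw [tendsto_iff_dist_tendsto_zero]
  refine squeeze_zero (fun _ => dist_nonneg) (fun n => ?_) (by simpa using h0.const_mul β)
  exact (hv.isMaxValue n).abs_sub_le hV' (fun x =>
    abs_actionValue_sub_le p r hβ (hm n) (hv.boundedFun n) hVu.measurable hVb (hVdist n) x) s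

end Bellman

/-! ### Order properties of the Bellman operator -/

section BellmanOrder

variable {S A : Type*} [MeasurableSpace S] [MeasurableSpace A] [Lattice S] [Lattice A]
  {p : Kernel (S × A) S}

lemma supermodular_actionValue (hpsup : KernelSupermodular p) {r : S × A → ℝ}
    (hr : Supermodular r) {β : ℝ} (hβ : 0 ≤ β) {v : S → ℝ} (hvm : Measurable v)
    (hvb : BoundedFun v) (hv : Supermodular v) : Supermodular (actionValue p r β v) := by
  intro x y
  have h1 := hr x y
  have h2 := mul_le_mul_of_nonneg_left (hpsup v hvm hvb hv x y) hβ
  simp only [actionValue]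
  linarith

lemma monotone_integral_sub [IsMarkovKernel p] (hpinc : KernelIncreasing p) {v₁ v₂ : S → ℝ}
    (hm₁ : Measurable v₁)
    (hb₁ : BoundedFun v₁) (hm₂ : Measurable v₂) (hb₂ : BoundedFun v₂)
    (h : Monotone fun s => v₂ s - v₁ s) :
    Monotone fun x : S × A => (∫ s, v₂ s ∂(p x)) - ∫ s, v₁ s ∂(p x) := by
  have hmono := hpinc _ (hm₂.sub hm₁) (hb₂.sub hb₁) h
  intro x y hxy
  simpa only [Pi.sub_apply, integral_sub (hb₂.integrable hm₂ _) (hb₁.integrable hm₁ _)]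
    using hmono hxy

end BellmanOrder

/-! ### Payoffs of strategies and solutions of the Bellman equation -/

section Payoff

variable {S A : Type*} [MeasurableSpace S] [MeasurableSpace A] (p : Kernel (S × A) S)
  [IsMarkovKernel p] {Γ : S → Set A} (σ : Strategy Γ) (s : S)

instance : IsProbabilityMeasure (histLaw p σ s) := by
  unfold histLaw
  infer_instance

lemma integral_stepKernel (t : ℕ) (h : Finset.Iic t → S × A) {g : S × A → ℝ} (hg : Measurable g)
    (hgb : BoundedFun g) :
    ∫ y, g y ∂(stepKernel p σ t h) =
      ∫ s', g (s', σ.next t (h, s')) ∂(p (h ⟨t, Finset.mem_Iic.2 le_rfl⟩)) := by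
  have hi : Integrable g (stepKernel p σ t h) := hgb.integrable hg _
  unfold stepKernel at hi ⊢
  rw [integral_compProd hi]
  simp only [Kernel.comap_apply, Kernel.deterministic_apply]
  refine integral_congr_ae (ae_of_all _ fun s' => ?_)
  exact integral_dirac' _ _ (hg.comp measurable_prodMk_left).stronglyMeasurable

lemma integral_histLaw_zero {g : S × A → ℝ} (hg : Measurable g) :
    ∫ ω, g (ω 0) ∂(histLaw p σ s) = g (s, σ.first s) := by
  have hg' : Measurable fun h : (i : Finset.Iic 0) → S × A =>
      g (h ⟨0, Finset.mem_Iic.2 le_rfl⟩) := hg.comp (measurable_pi_apply _)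
  have h := Kernel.traj_map_frestrictLe_apply (X := fun _ => S × A) (κ := stepKernel p σ) 0 0
    (fun _ => (s, σ.first s))
  rw [Kernel.partialTraj_self, Kernel.id_apply] at h
  have h2 := congrArg (fun μ => ∫ h, g (h ⟨0, Finset.mem_Iic.2 le_rfl⟩) ∂μ) h
  rw [integral_map (by fun_prop) hg'.aestronglyMeasurable,
    integral_dirac' _ _ hg'.stronglyMeasurable] at h2
  exact h2

/-- Conditioning on the history up to `t`: its joint law with the next pair is a composition product
with `stepKernel`. -/
lemma integral_histLaw_succ (t : ℕ) {g : S × A → ℝ} (hg : Measurable g) (hgb : BoundedFun g) :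
    ∫ ω, g (ω (t + 1)) ∂(histLaw p σ s) =
      ∫ ω, ∫ s', g (s', σ.next t (Preorder.frestrictLe t ω, s')) ∂(p (ω t))
        ∂(histLaw p σ s) := by
  have h := Kernel.partialTraj_compProd_eq_map_traj (X := fun _ => S × A) (κ := stepKernel p σ)
    (Nat.zero_le t) (x₀ := fun _ => (s, σ.first s))
  have hm := Kernel.traj_map_frestrictLe_apply (X := fun _ => S × A) (κ := stepKernel p σ) 0 t
    (fun _ => (s, σ.first s))
  have hg2 : Measurable fun y : (Finset.Iic t → S × A) × (S × A) => g y.2 :=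
    hg.comp measurable_snd
  have h2 := congrArg (fun μ => ∫ y, g y.2 ∂μ) h
  rw [integral_map (by fun_prop) hg2.aestronglyMeasurable,
    Measure.integral_compProd ((hgb.comp Prod.snd).integrable hg2 _), ← hm,
    integral_map (by fun_prop)
      (hg.stronglyMeasurable.integral_kernel (κ := stepKernel p σ t)).aestronglyMeasurable] at h2
  refine h2.symm.trans (integral_congr_ae (ae_of_all _ fun ω => ?_))
  exact integral_stepKernel p σ t _ hg hgb

/-- The payoff of a strategy is the sum of the discounted expected payoffs of the periods. -/
lemma payoff_eq_tsum {r : S × A → ℝ} (hr : Measurable r) (hrb : BoundedFun r) {β : ℝ}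
    (hβ : 0 ≤ β) (hβ' : β < 1) :
    payoff p r β σ s = ∑' t : ℕ, β ^ t * ∫ ω, r (ω t) ∂(histLaw p σ s) := by
  have hm (t : ℕ) : Measurable fun ω : ℕ → S × A => r (ω t) := hr.comp (measurable_pi_apply t)
  have hi (t : ℕ) : Integrable (fun ω : ℕ → S × A => r (ω t)) (histLaw p σ s) :=
    (hrb.comp _).integrable (hm t) _
  unfold payoff
  rw [← integral_tsum_of_summable_integral_norm (fun t => (hi t).const_mul (β ^ t))]
  · simp only [integral_const_mul]
  · obtain ⟨M, hM⟩ := hrb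
    refine Summable.of_nonneg_of_le (fun t => integral_nonneg fun _ => norm_nonneg _) (fun t => ?_)
      ((summable_geometric_of_lt_one hβ hβ').mul_right M)
    refine (le_abs_self _).trans (abs_integral_le_of_forall_abs_le (fun ω => ?_) _)
    rw [abs_norm, Real.norm_eq_abs, abs_mul, abs_of_nonneg (pow_nonneg hβ t)]
    exact mul_le_mul_of_nonneg_left (hM _) (pow_nonneg hβ t)

lemma BoundedFun.summable_pow_mul {d : ℕ → ℝ} (hd : BoundedFun d) {β : ℝ} (hβ : 0 ≤ β)
    (hβ' : β < 1) : Summable fun t => β ^ t * d t := by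
  obtain ⟨M, hM⟩ := hd
  refine Summable.of_norm_bounded ((summable_geometric_of_lt_one hβ hβ').mul_right M) fun t => ?_
  rw [Real.norm_eq_abs, abs_mul, abs_of_nonneg (pow_nonneg hβ t)]
  exact mul_le_mul_of_nonneg_left (hM t) (pow_nonneg hβ t)

lemma BoundedFun.integral_histLaw {g : S × A → ℝ} (hg : BoundedFun g) :
    BoundedFun fun t : ℕ => ∫ ω, g (ω t) ∂(histLaw p σ s) := by
  obtain ⟨M, hM⟩ := hg
  exact ⟨M, fun t => abs_integral_le_of_forall_abs_le (fun ω => hM _) _⟩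

/-- The difference between the payoff of a strategy and a function `v` is the discounted sum of
the expected one-period losses with respect to `v`. -/
lemma payoff_eq_add_tsum {r : S × A → ℝ} (hr : Measurable r) (hrb : BoundedFun r) {β : ℝ}
    (hβ : 0 ≤ β) (hβ' : β < 1) {v : S → ℝ} (hv : Measurable v) (hvb : BoundedFun v) :
    payoff p r β σ s = v s +
      ∑' t : ℕ, β ^ t * ∫ ω, (actionValue p r β v (ω t) - v (ω t).1) ∂(histLaw p σ s) := by
  set m : ℕ → ℝ := fun t => ∫ ω, v (ω t).1 ∂(histLaw p σ s) with hm_def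
  have hvf : Measurable fun x : S × A => v x.1 := hv.comp measurable_fst
  have hvfb : BoundedFun fun x : S × A => v x.1 := hvb.comp _
  have hm0 : m 0 = v s := integral_histLaw_zero p σ s hvf
  have hmb : BoundedFun m := hvfb.integral_histLaw p σ s
  have hq := measurable_actionValue p hr β hv
  have hqb := hrb.actionValue (p := p) β hvb
  have hint {g : S × A → ℝ} (hg : Measurable g) (hgb : BoundedFun g) (t : ℕ) :
      Integrable (fun ω : ℕ → S × A => g (ω t)) (histLaw p σ s) :=
    (hgb.comp _).integrable (hg.comp (measurable_pi_apply t)) _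
  have hpv : Measurable fun x : S × A => ∫ s', v s' ∂(p x) :=
    (hv.stronglyMeasurable.integral_kernel (κ := p)).measurable
  -- As `v` ignores the action, the expected continuation value at period `t` is `m (t + 1)`; the
  -- weighted differences then telescope to `-m 0`.
  have hstep (t : ℕ) : ∫ ω, (actionValue p r β v (ω t) - v (ω t).1) ∂(histLaw p σ s) =
      (∫ ω, r (ω t) ∂(histLaw p σ s)) + (β * m (t + 1) - m t) := by
    rw [integral_sub (hint hq hqb t) (hint hvf hvfb t)]
    simp only [actionValue]
    rw [integral_add (hint hr hrb t) ((hint hpv (hvb.integral p) t).const_mul β),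
      integral_const_mul, hm_def]
    dsimp only
    rw [integral_histLaw_succ p σ s t hvf hvfb]
    ring
  have hsm := hmb.summable_pow_mul hβ hβ'
  have htel := hsm.tsum_eq_zero_add
  rw [payoff_eq_tsum p σ s hr hrb hβ hβ']
  have hsum : ∀ t, β ^ t * ∫ ω, (actionValue p r β v (ω t) - v (ω t).1) ∂(histLaw p σ s) =
      β ^ t * (∫ ω, r (ω t) ∂(histLaw p σ s)) + (β ^ (t + 1) * m (t + 1) - β ^ t * m t) := by
    intro t
    rw [hstep]
    ring
  have hsm' : Summable fun t => β ^ (t + 1) * m (t + 1) := (summable_nat_add_iff 1).2 hsm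
  simp only [hsum]
  rw [((hrb.integral_histLaw p σ s).summable_pow_mul hβ hβ').tsum_add (hsm'.sub hsm),
    hsm'.tsum_sub hsm, htel, pow_zero, hm0]
  ring

/-- No strategy does better than a solution of the Bellman equation. -/
lemma IsMaxValue.payoff_le {r : S × A → ℝ} (hr : Measurable r) (hrb : BoundedFun r) {β : ℝ}
    (hβ : 0 ≤ β) (hβ' : β < 1) {v : S → ℝ} (hv : Measurable v) (hvb : BoundedFun v)
    (h : IsMaxValue Γ (actionValue p r β v) v) : payoff p r β σ s ≤ v s := by
  rw [payoff_eq_add_tsum p σ s hr hrb hβ hβ' hv hvb, add_le_iff_nonpos_right]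
  refine tsum_nonpos fun t => mul_nonpos_of_nonneg_of_nonpos (pow_nonneg hβ t) ?_
  have hg : Measurable fun x : S × A => actionValue p r β v x - v x.1 :=
    (measurable_actionValue p hr β hv).sub (hv.comp measurable_fst)
  have hgb : BoundedFun fun x : S × A => actionValue p r β v x - v x.1 :=
    (hrb.actionValue β hvb).sub (hvb.comp _)
  -- The loss has a sign only at feasible pairs, and arbitrary `ω` need not be feasible;
  -- conditioning on the preceding period exposes the action chosen by `σ`.
  cases t with
  | zero =>
    rw [integral_histLaw_zero p σ s hg]
    exact sub_nonpos.2 (h.le (σ.first_mem s))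
  | succ t =>
    rw [integral_histLaw_succ p σ s t hg hgb]
    exact integral_nonpos fun ω => integral_nonpos fun s' =>
      sub_nonpos.2 (h.le (σ.next_mem t _ s'))

/-- The strategy that always follows the policy `φ`. -/
def stationaryStrategy (φ : S → A) (hφ : Measurable φ) (hφΓ : ∀ s, φ s ∈ Γ s) : Strategy Γ where
  first := φ
  measurable_first := hφ
  first_mem := hφΓ
  next _ x := φ x.2
  measurable_next _ := hφ.comp measurable_snd
  next_mem _ _ s := hφΓ s

lemma payoff_stationaryStrategy {r : S × A → ℝ} (hr : Measurable r) (hrb : BoundedFun r) {β : ℝ}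
    (hβ : 0 ≤ β) (hβ' : β < 1) {v : S → ℝ} (hv : Measurable v) (hvb : BoundedFun v)
    {φ : S → A} (hφ : Measurable φ) (hφΓ : ∀ s, φ s ∈ Γ s)
    (h : ∀ s, actionValue p r β v (s, φ s) = v s) :
    payoff p r β (stationaryStrategy φ hφ hφΓ) s = v s := by
  rw [payoff_eq_add_tsum p _ s hr hrb hβ hβ' hv hvb, add_eq_left]
  have hg : Measurable fun x : S × A => actionValue p r β v x - v x.1 :=
    (measurable_actionValue p hr β hv).sub (hv.comp measurable_fst)
  have hgb : BoundedFun fun x : S × A => actionValue p r β v x - v x.1 :=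
    (hrb.actionValue β hvb).sub (hvb.comp _)
  have hzero (t : ℕ) : ∫ ω, (actionValue p r β v (ω t) - v (ω t).1)
      ∂(histLaw p (stationaryStrategy φ hφ hφΓ) s) = 0 := by
    cases t with
    | zero =>
      rw [integral_histLaw_zero p _ s hg]
      exact sub_eq_zero.2 (h s)
    | succ t =>
      rw [integral_histLaw_succ p _ s t hg hgb]
      simp only [stationaryStrategy, h, sub_self, integral_zero]
  simp only [hzero, mul_zero, tsum_zero]

/-- If the Bellman equation has a solution with a measurable optimal policy, then the solution is
the value function. -/
lemma IsMaxValue.valueFn_eq {r : S × A → ℝ} (hr : Measurable r) (hrb : BoundedFun r) {β : ℝ}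
    (hβ : 0 ≤ β) (hβ' : β < 1) {v : S → ℝ} (hv : Measurable v) (hvb : BoundedFun v)
    (h : IsMaxValue Γ (actionValue p r β v) v) {φ : S → A} (hφ : Measurable φ)
    (hφΓ : ∀ s, φ s ∈ Γ s) (hφv : ∀ s, actionValue p r β v (s, φ s) = v s) :
    valueFn p Γ r β = v := by
  funext s
  refine IsGreatest.csSup_eq ⟨⟨stationaryStrategy φ hφ hφΓ, ?_⟩, ?_⟩
  · exact payoff_stationaryStrategy p s hr hrb hβ hβ' hv hvb hφ hφΓ hφv
  · rintro _ ⟨σ, rfl⟩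
    exact h.payoff_le p σ s hr hrb hβ hβ' hv hvb

end Payoff

/-! ### Greatest optimal policies -/

section Policy

variable {k : ℕ} {A : Sublattice (Fin k → ℝ)}

lemma continuous_coord_sublattice (i : Fin k) : Continuous fun a : A => a.1 i :=
  (continuous_apply i).comp continuous_subtype_val

/-- A maximizer of the coordinate sum is greatest: joining it with an element not below it would
strictly raise the sum. -/
lemma IsCompact.exists_isGreatest_of_supClosed {M : Set A} (hM : IsCompact M) (hne : M.Nonempty)
    (hsup : SupClosed M) : ∃ a, IsGreatest M a := by
  have hc : Continuous fun a : A => ∑ i, a.1 i :=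
    continuous_finsetSum _ fun i _ => continuous_coord_sublattice i
  obtain ⟨a, ha, ham⟩ := hM.exists_isMaxOn hne hc.continuousOn
  refine ⟨a, ha, fun b hb => ?_⟩
  by_contra hba
  obtain ⟨i, hi⟩ : ∃ i, a.1 i < b.1 i := by
    by_contra! h
    exact hba h
  have hlt : ∑ i, a.1 i < ∑ i, (a ⊔ b).1 i :=
    Finset.sum_lt_sum (fun j _ => (le_sup_left : a ≤ a ⊔ b) j)
      ⟨i, Finset.mem_univ i, hi.trans_le ((le_sup_right : b ≤ a ⊔ b) i)⟩
  exact (ham (hsup ha hb)).not_gt hlt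

lemma measurable_of_measurableSet_coord {S : Type*} [MeasurableSpace S] {φ : S → A}
    (h : ∀ (i : Fin k) (c : ℝ), MeasurableSet {s | c ≤ (φ s).1 i}) : Measurable φ :=
  (measurable_pi_lambda _ fun i => measurable_of_Ici fun c => h i c).subtype_mk

/-- Supermodular objectives have a measurable selection of maximizers, the greatest ones. -/
lemma IsMaxValue.exists_measurable_policy {S : Type*} [Lattice S] [TopologicalSpace S]
    [MeasurableSpace S] [OpensMeasurableSpace S] {Γ : S → Set A}
    (hΓ : UpperHemicontinuous Γ) (hΓc : ∀ s, IsCompact (Γ s)) (hΓsup : SupermodularCorrespondence Γ)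
    {w : S × A → ℝ} (hw : UpperSemicontinuous w) (hws : Supermodular w) {v : S → ℝ}
    (h : IsMaxValue Γ w v) :
    ∃ φ : S → A, Measurable φ ∧ ∀ s, φ s ∈ Γ s ∧ w (s, φ s) = v s := by
  have hgr (s : S) : ∃ a, IsGreatest {a ∈ Γ s | w (s, a) = v s} a := by
    refine IsCompact.exists_isGreatest_of_supClosed ?_ (h.exists_eq s) ?_
    · have heq : {a ∈ Γ s | w (s, a) = v s} = Γ s ∩ (fun a => w (s, a)) ⁻¹' Set.Ici (v s) := by
        ext a
        exact and_congr_right fun ha => ⟨fun e => e.ge, fun e => (h.le ha).antisymm e⟩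
      rw [heq]
      exact (hΓc s).inter_right
        ((hw.comp (Continuous.prodMk_right s)).isClosed_preimage (v s))
    · intro a ha b hb
      exact (JointlySupermodular.argmax_sup_inf hΓsup h h hws le_rfl ha.1 hb.1 ha.2 hb.2).1
  choose φ hφ using hgr
  refine ⟨φ, measurable_of_measurableSet_coord fun i c => ?_, fun s => (hφ s).1⟩
  -- Since `φ s` is the greatest maximizer, its coordinate `i` is at least `c` iff that of some
  -- maximizer is.
  convert! h.measurableSet_exists_mem hΓ hΓc hw
    (isClosed_Ici.preimage (continuous_coord_sublattice i) : IsClosed {a : A | c ≤ a.1 i}) using 1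
  ext s
  constructor
  · intro hs
    exact ⟨φ s, (hφ s).1.1, hs, (hφ s).1.2⟩
  · rintro ⟨a, ha, hac, hav⟩
    exact le_trans hac ((hφ s).2 ⟨ha, hav⟩ i)

end Policy

/-! ### The value function as a limit of value iterates -/

section Value

variable {n k : ℕ} {S : Sublattice (Fin n → ℝ)} {A : Sublattice (Fin k → ℝ)}
  {p : Kernel (S × A) S} {Γ : S → Set A}

lemma supermodular_of_tendsto {X : Type*} [Lattice X] {f : ℕ → X → ℝ} {g : X → ℝ}
    (h : ∀ x, Tendsto (fun n => f n x) atTop (𝓝 (g x))) (hf : ∀ n, Supermodular (f n)) :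
    Supermodular g := fun x y =>
  le_of_tendsto_of_tendsto' ((h x).add (h y)) ((h _).add (h _)) fun n => hf n x y

lemma monotone_of_tendsto {X : Type*} [Preorder X] {f : ℕ → X → ℝ} {g : X → ℝ}
    (h : ∀ x, Tendsto (fun n => f n x) atTop (𝓝 (g x))) (hf : ∀ n, Monotone (f n)) :
    Monotone g := fun x y hxy =>
  le_of_tendsto_of_tendsto' (h x) (h y) fun n => hf n hxy

lemma IsValueIteration.supermodular (hpsup : KernelSupermodular p)
    (hΓsup : SupermodularCorrespondence Γ) {r : S × A → ℝ} (hr : Supermodular r) {β : ℝ}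
    (hβ : 0 ≤ β) {v : ℕ → S → ℝ} (hv : IsValueIteration p Γ r β v) (m : ℕ) :
    Supermodular (v m) := by
  induction m with
  | zero => intro x y; simp [hv.zero]
  | succ m ih =>
    exact JointlySupermodular.isMaxValue hΓsup (hv.isMaxValue m) (hv.isMaxValue m)
      (supermodular_actionValue hpsup hr hβ (hv.upperSemicontinuous m).measurable
        (hv.boundedFun m) ih)

lemma IsValueIteration.monotone (hpinc : KernelIncreasing p)
    (hΓmono : ∀ ⦃s₁ s₂ : S⦄, s₁ ≤ s₂ → Γ s₁ ⊆ Γ s₂) {r : S × A → ℝ}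
    (hr : ∀ a : A, Monotone fun s : S => r (s, a)) {β : ℝ}
    (hβ : 0 ≤ β) {v : ℕ → S → ℝ} (hv : IsValueIteration p Γ r β v) (m : ℕ) :
    Monotone (v m) := by
  induction m with
  | zero => rw [hv.zero]; exact monotone_const
  | succ m ih =>
    refine (hv.isMaxValue m).monotone hΓmono fun a s t hst => ?_
    have := hpinc _ (hv.upperSemicontinuous m).measurable (hv.boundedFun m) ih
      (Prod.mk_le_mk.2 ⟨hst, le_refl a⟩)
    exact add_le_add (hr a hst) (mul_le_mul_of_nonneg_left this hβ)

/-- The value function is regular, supermodular, solves the Bellman equation and is the limit of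
the value iterates. -/
lemma exists_isValueIteration_tendsto_valueFn [IsMarkovKernel p] (hp : KernelUSC p)
    (hΓ : UpperHemicontinuous Γ) (hΓne : ∀ s, (Γ s).Nonempty) (hΓc : ∀ s, IsCompact (Γ s))
    (hpsup : KernelSupermodular p)
    (hΓsup : SupermodularCorrespondence Γ) {r : S × A → ℝ} (hrb : BoundedFun r)
    (hr : UpperSemicontinuous r) (hrs : Supermodular r) {β : ℝ} (hβ : 0 ≤ β) (hβ' : β < 1) :
    UpperSemicontinuous (valueFn p Γ r β) ∧ BoundedFun (valueFn p Γ r β) ∧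
      Supermodular (valueFn p Γ r β) ∧
      IsMaxValue Γ (actionValue p r β (valueFn p Γ r β)) (valueFn p Γ r β) ∧
      ∃ v, IsValueIteration p Γ r β v ∧
        ∀ s, Tendsto (fun m => v m s) atTop (𝓝 (valueFn p Γ r β s)) := by
  obtain ⟨v, hv⟩ := exists_isValueIteration hp hΓ hΓne hΓc hr hrb hβ
  obtain ⟨V, hVu, hVb, hVm, hV⟩ := hv.exists_tendsto hp hΓne hΓc hr hβ hβ'
  -- Needed before `V` is identified with the value function, because the measurable policy relies
  -- on it.
  have hVs : Supermodular V := supermodular_of_tendsto hV (hv.supermodular hpsup hΓsup hrs hβ)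
  obtain ⟨φ, hφ, hφv⟩ := hVm.exists_measurable_policy hΓ hΓc hΓsup
    (upperSemicontinuous_actionValue hp hr hβ hVu hVb)
    (supermodular_actionValue hpsup hrs hβ hVu.measurable hVb hVs)
  have hval : valueFn p Γ r β = V := hVm.valueFn_eq p hr.measurable hrb hβ hβ' hVu.measurable hVb
    hφ (fun s => (hφv s).1) fun s => (hφv s).2
  rw [hval]
  exact ⟨hVu, hVb, hVs, hVm, v, hv, hV⟩

/-- Comparison of two discounted programs. Let `P` be a property of the value iterates of the second
program that passes to their limit. If increasing differences of continuation values with `P` lead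
to increasing differences of action values, then the optimal actions of the second program dominate
those of the first one at any smaller state. -/
lemma setDominates_optimalPolicy [IsMarkovKernel p] (hp : KernelUSC p)
    (hΓ : UpperHemicontinuous Γ) (hΓne : ∀ s, (Γ s).Nonempty) (hΓc : ∀ s, IsCompact (Γ s))
    (hpsup : KernelSupermodular p)
    (hΓsup : SupermodularCorrespondence Γ) {r₁ r₂ : S × A → ℝ} (hrb₁ : BoundedFun r₁)
    (hr₁ : UpperSemicontinuous r₁) (hrs₁ : Supermodular r₁) (hrb₂ : BoundedFun r₂)
    (hr₂ : UpperSemicontinuous r₂) (hrs₂ : Supermodular r₂) {β₁ β₂ : ℝ} (hβ₁ : 0 ≤ β₁)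
    (hβ₁' : β₁ < 1) (hβ₂ : 0 ≤ β₂) (hβ₂' : β₂ < 1) {P : (S → ℝ) → Prop}
    (hP : ∀ v, IsValueIteration p Γ r₂ β₂ v → ∀ m, P (v m))
    (hPlim : ∀ (v : ℕ → S → ℝ) (V : S → ℝ), (∀ m, P (v m)) →
      (∀ s, Tendsto (fun m => v m s) atTop (𝓝 (V s))) → P V)
    (hstep : ∀ v₁ v₂ : S → ℝ, Measurable v₁ → BoundedFun v₁ → Measurable v₂ → BoundedFun v₂ →
      P v₂ → (Monotone fun s => v₂ s - v₁ s) →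
      Monotone fun x => actionValue p r₂ β₂ v₂ x - actionValue p r₁ β₁ v₁ x)
    {s₁ s₂ : S} (hs : s₁ ≤ s₂) :
    SetDominates (optimalPolicy p Γ r₂ β₂ s₂) (optimalPolicy p Γ r₁ β₁ s₁) := by
  obtain ⟨hu₁, hb₁, hsm₁, hmax₁, v₁, hv₁, ht₁⟩ := exists_isValueIteration_tendsto_valueFn hp hΓ
    hΓne hΓc hpsup hΓsup hrb₁ hr₁ hrs₁ hβ₁ hβ₁'
  obtain ⟨hu₂, hb₂, hsm₂, hmax₂, v₂, hv₂, ht₂⟩ := exists_isValueIteration_tendsto_valueFn hp hΓ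
    hΓne hΓc hpsup hΓsup hrb₂ hr₂ hrs₂ hβ₂ hβ₂'
  have hiter (m : ℕ) : Monotone fun s => v₂ m s - v₁ m s := by
    induction m with
    | zero => simpa [hv₁.zero, hv₂.zero] using monotone_const
    | succ m ih =>
      have hsm := supermodular_actionValue hpsup hrs₁ hβ₁ (hv₁.upperSemicontinuous m).measurable
        (hv₁.boundedFun m) (hv₁.supermodular hpsup hΓsup hrs₁ hβ₁ m)
      exact (JointlySupermodular.isMaxValue hΓsup (hv₁.isMaxValue m) (hv₂.isMaxValue m)
        (hsm.jointlySupermodular (hstep _ _ (hv₁.upperSemicontinuous m).measurable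
          (hv₁.boundedFun m) (hv₂.upperSemicontinuous m).measurable (hv₂.boundedFun m)
          (hP v₂ hv₂ m) ih))).monotone_sub
  have hlim : Monotone fun s => valueFn p Γ r₂ β₂ s - valueFn p Γ r₁ β₁ s :=
    monotone_of_tendsto (fun s => (ht₂ s).sub (ht₁ s)) hiter
  have hw := (supermodular_actionValue hpsup hrs₁ hβ₁ hu₁.measurable hb₁
    hsm₁).jointlySupermodular (hstep _ _ hu₁.measurable hb₁ hu₂.measurable hb₂
      (hPlim v₂ _ (hP v₂ hv₂) ht₂) hlim)
  have hopt {r : S × A → ℝ} {β : ℝ}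
      (h : IsMaxValue Γ (actionValue p r β (valueFn p Γ r β)) (valueFn p Γ r β)) (s : S) (a : A) :
      a ∈ optimalPolicy p Γ r β s ↔
        a ∈ Γ s ∧ actionValue p r β (valueFn p Γ r β) (s, a) = valueFn p Γ r β s :=
    and_congr_right fun ha => h.isMaxOn_iff ha
  refine ⟨?_, ?_, fun a ha b hb => ?_⟩
  · obtain ⟨a, ha⟩ := hmax₂.exists_eq s₂
    exact ⟨a, (hopt hmax₂ _ _).2 ha⟩
  · obtain ⟨a, ha⟩ := hmax₁.exists_eq s₁
    exact ⟨a, (hopt hmax₁ _ _).2 ha⟩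
  · rw [hopt hmax₂] at ha
    rw [hopt hmax₁] at hb
    rw [hopt hmax₂, hopt hmax₁]
    exact JointlySupermodular.argmax_sup_inf hΓsup hmax₁ hmax₂ hw hs ha.1 hb.1 ha.2 hb.2

/-- The case `e₁ = e₂` is the sublattice property. -/
lemma ascending_of_setDominates {E X : Type*} [Preorder E] [Lattice X] {Λ : E → Set X}
    (h : ∀ ⦃e₁ e₂ : E⦄, e₁ ≤ e₂ → SetDominates (Λ e₂) (Λ e₁)) : Ascending Λ :=
  ⟨fun e => ⟨fun _ ha _ hb => ((h (le_refl e)).2.2 _ ha _ hb).1,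
    fun _ ha _ hb => ((h (le_refl e)).2.2 _ ha _ hb).2⟩, h⟩

end Value

end DiscountedDP

open DiscountedDP
theorem mainTheorem8 {n k : ℕ}
    (S : Sublattice (Fin n → ℝ)) (hS : MeasurableSet (S : Set (Fin n → ℝ)))
    (A : Sublattice (Fin k → ℝ)) (hA : MeasurableSet (A : Set (Fin k → ℝ)))
    (p : Kernel (S × A) S) [IsMarkovKernel p] (hp : KernelUSC p)
    (Γ : S → Set A) (hΓ : UpperHemicontinuous Γ)
    (hΓne : ∀ s, (Γ s).Nonempty) (hΓc : ∀ s, IsCompact (Γ s))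
    (hpinc : KernelIncreasing p) (hpsup : KernelSupermodular p)
    (hΓsup : SupermodularCorrespondence Γ) :
    (∀ r : S × A → ℝ, BoundedFun r → UpperSemicontinuous r →
      Supermodular r → (∀ a : A, Monotone fun s : S => r (s, a)) →
      (∀ ⦃s₁ s₂ : S⦄, s₁ ≤ s₂ → Γ s₁ ⊆ Γ s₂) →
      Ascending fun x : S × Set.Ioo (0 : ℝ) 1 => optimalPolicy p Γ r x.2 x.1) ∧
    (∀ (E : Type*) [PartialOrder E] (β : ℝ), 0 < β → β < 1 →
      ∀ r : (S × A) × E → ℝ,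
      (∀ c : E, BoundedFun fun x : S × A => r (x, c)) →
      (∀ c : E, UpperSemicontinuous fun x : S × A => r (x, c)) →
      (∀ c : E, Supermodular fun x : S × A => r (x, c)) →
      IncreasingDifferences r →
      Ascending fun x : S × E => optimalPolicy p Γ (fun y : S × A => r (y, x.2)) β x.1) := by

  constructor
  · intro r hrb hr hrs hrmono hΓmono
    refine ascending_of_setDominates ?_
    rintro ⟨s₁, β₁, h₁⟩ ⟨s₂, β₂, h₂⟩ ⟨hs, hβ : β₁ ≤ β₂⟩
    refine setDominates_optimalPolicy hp hΓ hΓne hΓc hpsup hΓsup hrb hr hrs hrb hr hrs h₁.1.le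
      h₁.2 h₂.1.le h₂.2 (P := Monotone)
      (fun v hv => hv.monotone hpinc hΓmono hrmono h₂.1.le)
      (fun v V hv hV => monotone_of_tendsto hV hv) ?_ hs
    intro v₁ v₂ hm₁ hb₁ hm₂ hb₂ hmono hsub x y hxy
    -- The payoff cancels, and the difference of action values is `(β₂ - β₁) ∫ v₂ + β₁ (∫ v₂ - ∫
    -- v₁)`.
    have e1 := mul_le_mul_of_nonneg_left (hpinc v₂ hm₂ hb₂ hmono hxy) (sub_nonneg.2 hβ)
    have e2 := mul_le_mul_of_nonneg_left
      (monotone_integral_sub hpinc hm₁ hb₁ hm₂ hb₂ hsub hxy) h₁.1.le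
    simp only [actionValue]
    linarith
  · intro E _ β hβ hβ' r hrb hr hrs hrinc
    refine ascending_of_setDominates ?_
    rintro ⟨s₁, c₁⟩ ⟨s₂, c₂⟩ ⟨hs, hc : c₁ ≤ c₂⟩
    -- With a common discount factor no monotonicity of the iterates is required, so `P` is trivial.
    refine setDominates_optimalPolicy hp hΓ hΓne hΓc hpsup hΓsup (hrb c₁) (hr c₁) (hrs c₁)
      (hrb c₂) (hr c₂) (hrs c₂) hβ.le hβ' hβ.le hβ' (P := fun _ => True) (fun _ _ _ => trivial)
      (fun _ _ _ _ => trivial) ?_ hs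
    intro v₁ v₂ hm₁ hb₁ hm₂ hb₂ _ hsub x y hxy
    have e1 := hrinc hxy hc
    have e2 := mul_le_mul_of_nonneg_left
      (monotone_integral_sub hpinc hm₁ hb₁ hm₂ hb₂ hsub hxy) hβ.le
    simp only [actionValue]
    linarith
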